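/- Let $D$ be the open unit disk, let $\frac{\partial}{\partial\bar z}=\frac12\left(\frac{\partial}{\partial x}+i\frac{\partial}{\partial y}\right)$, and let $\mathcal D'(\partial D)$ be the space of distributions on $\partial D$, with test functions $\varphi\in C^\infty(\partial D)$ written in the angle $\theta$. A function $g$ on $D$ has the boundary value $g_b\in\mathcal D'(\partial D)$ in the sense of distributions if $\langle g_b,\varphi\rangle=\lim_{r\nearrow1}\int_0^{2\pi}g(re^{i\theta})\varphi(\theta)\,d\theta$ for every $\varphi\in C^\infty(\partial D)$. Let $H_b$ be the set of holomorphic functions on $D$ that have such a boundary value, and let $\mathrm{Re}\{(H^p(D))_b\}$ be the set of real parts of the boundary values of the functions in the Hardy space $H^p(D)$. For a distribution $u$ put $\langle\bar u,\varphi\rangle=\overline{\langle u,\bar\varphi\rangle}$, $\mathrm{Re}\,u=\frac{1}{2}(u+\bar u)$ and $\mathrm{Im}\,u=\frac1{2i}(u-\bar u)$. **Theorem.** Let $n\ge1$ be an integer, $h_0\in H_b$, $h_k\in\mathrm{Re}\{(H^{p_k}(D))_b\}$ with $\frac12<p_k\le1$ for $1\le k\le n-1$, and $c_k\in\mathbb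 R$ for $0\le k\le n-1$. Let $f$ solve in $D$ the Schwarz problem $$\frac{\partial^nf}{\partial\bar z^n}=0,\qquad \mathrm{Re}\{f_b\}=\mathrm{Re}\{(h_0)_b\},\qquad \mathrm{Re}\left\{\left(\frac{\partial^kf}{\partial\bar z^k}\right)_b\right\}=h_k\ (1\le k\le n-1),\qquad \mathrm{Im}\left\{\frac{\partial^kf}{\partial\bar z^k}(0)\right\}=c_k\ (0\le k\le n-1),$$ where $f,\frac{\partial f}{\partial\bar z},\dots,\frac{\partial^{n-1}f}{\partial\bar z^{n-1}}$ are (real) differentiable in $D$ and have boundary values in the sense of distributions; $f$ is not assumed to be integrable. Let $h\in H_b$ and $c\in\mathbb R$. For $z=re^{i\theta}\in D$ put $$P_r(\theta)=\frac{1-r^2}{1-2r\cos\theta+r^2},\qquad Q_r(\theta)=\frac{2r\sin\theta}{1-2r\cos\theta+r^2},\qquad I=\frac{i}{2\pi}\langle\mathrm{Im}\,h_b,1\rangle,\qquad \widetilde I=\frac{i}{2\pi}\langle\mathrm{Im}\,(h_0)_b,1\rangle,$$ $$K_m(z)(\cdot)=\left(P_r(\theta-\cdot)+iQ_r(\theta-\cdot)\right)\left(e^{i(\cdot)}-re^{i\theta}+\overline{e^{i(\cdot)}-re^{i\theta}}\right)^m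 .$$ Then the function $$\begin{aligned}w(z)={}&ic-I+\frac1{2\pi}\langle h_b,P_r(\theta-\cdot)\rangle+\bar z\left(-\widetilde I+\frac1{2\pi}\langle(h_0)_b,P_r(\theta-\cdot)\rangle\right)\\&-i\sum_{k=1}^n\sum_{\ell=k-1}^{n-1}\frac{(-1)^kc_\ell}{k!\,(\ell-k+1)!}\,\bar z^k(z+\bar z)^{\ell-k+1}\\&-\sum_{k=1}^n\ \sum_{\ell=\max(1,k-1)}^{n-1}\frac{(-1)^{\ell+1}}{2\pi\,k!\,(\ell-k+1)!}\,\bar z^k\,\langle h_\ell,K_{\ell-k+1}(z)\rangle\end{aligned}$$ is differentiable in $D$, has a boundary value $w_b$ in the sense of distributions, and solves the first-order Schwarz problem $$\frac{\partial w}{\partial\bar z}=f\ \text{ in }D,\qquad \mathrm{Re}\{w_b\}=\mathrm{Re}\left\{h_b-\sum_{k=1}^n\frac{(-1)^k}{k!}e^{-ik(\cdot)}\left(\frac{\partial^{k-1}f}{\partial\bar z^{k-1}}\right)_b\right\},\qquad \mathrm{Im}\{w(0)\}=c.$$ Moreover, with $w_0(z)=ic-I+\frac1{2\pi}\langle h_b,P_r(\theta-\cdot)\rangle$,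 which is holomorphic in $D$, $$w(z)=w_0(z)-\sum_{k=1}^n\frac{(-1)^k}{k!}\,\bar z^k\,\frac{\partial^{k-1}f}{\partial\bar z^{k-1}}(z)\qquad(z\in D).$$ -/

import Mathlib

open scoped ContDiff

noncomputable section

/-! ## Test functions and distributions on the unit circle -/

/-- `C^∞(∂D)`: functions on the unit circle, written in the angle `θ`, i.e. smooth `2π`-periodic
functions on the line. -/
def circleTest : Subalgebra ℂ (ℝ → ℂ) where
  carrier := {φ | ContDiff ℝ ∞ φ ∧ Function.Periodic φ (2 * Real.pi)}
  mul_mem' := fun ha hb => ⟨ha.1.mul hb.1, ha.2.mul hb.2⟩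
  add_mem' := fun ha hb => ⟨ha.1.add hb.1, ha.2.add hb.2⟩
  algebraMap_mem' := fun _ => ⟨contDiff_const, fun _ => rfl⟩

theorem circleTest_bounded (a : circleTest) (N : ℕ) :
    ∃ A : ℝ, 0 ≤ A ∧ ∀ j ≤ N, ∀ θ : ℝ, ‖iteratedDeriv j (a : ℝ → ℂ) θ‖ ≤ A := by
  have hper : ∀ j : ℕ, Function.Periodic (iteratedDeriv j (a : ℝ → ℂ)) (2 * Real.pi) := by
    intro j x
    have h := iteratedDeriv_comp_add_const j (a : ℝ → ℂ) (2 * Real.pi)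
    rw [a.2.2.funext] at h
    exact (congrFun h x).symm
  have hone : ∀ j : ℕ, ∃ A : ℝ, ∀ θ : ℝ, ‖iteratedDeriv j (a : ℝ → ℂ) θ‖ ≤ A := by
    intro j
    have hc : Continuous (iteratedDeriv j (a : ℝ → ℂ)) :=
      a.2.1.continuous_iteratedDeriv j (by exact_mod_cast le_top)
    obtain ⟨A, hA⟩ := (isCompact_Icc (a := (0 : ℝ)) (b := 2 * Real.pi)).exists_bound_of_continuousOn
      hc.continuousOn
    refine ⟨A, fun θ => ?_⟩
    obtain ⟨y, hy, hyeq⟩ := (hper j).exists_mem_Ico₀ Real.two_pi_pos θ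
    rw [hyeq]
    exact hA y ⟨hy.1, hy.2.le⟩
  choose A hA using hone
  refine ⟨∑ j ∈ Finset.range (N + 1), |A j|, Finset.sum_nonneg fun _ _ => abs_nonneg _, ?_⟩
  intro j hj θ
  calc ‖iteratedDeriv j (a : ℝ → ℂ) θ‖ ≤ |A j| := (hA j θ).trans (le_abs_self _)
    _ ≤ ∑ j ∈ Finset.range (N + 1), |A j| :=
      Finset.single_le_sum (f := fun j => |A j|) (fun _ _ => abs_nonneg _)
        (Finset.mem_range.2 (Nat.lt_succ_of_le hj))

/-- Continuity of a linear functional on `C^∞(∂D)` for the topology of uniform convergence of all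
derivatives: `|u(φ)| ≤ C max_{j ≤ N} sup_θ |φ^{(j)}(θ)|` for some `N` and `C`. -/
def IsCircleContinuous (u : circleTest →ₗ[ℂ] ℂ) : Prop :=
  ∃ (N : ℕ) (C : ℝ), 0 ≤ C ∧ ∀ (φ : circleTest) (M : ℝ),
    (∀ j ≤ N, ∀ θ : ℝ, ‖iteratedDeriv j (φ : ℝ → ℂ) θ‖ ≤ M) → ‖u φ‖ ≤ C * M

/-- `𝒟'(∂D)`: the continuous linear functionals on `C^∞(∂D)`. -/
def circleDistributions : Submodule ℂ (circleTest →ₗ[ℂ] ℂ) where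
  carrier := {u | IsCircleContinuous u}
  zero_mem' := ⟨0, 0, le_rfl, fun φ M _ => by simp⟩
  add_mem' := by
    rintro u v ⟨N, C, hC, hu⟩ ⟨N', C', hC', hv⟩
    refine ⟨max N N', C + C', add_nonneg hC hC', fun φ M hM => ?_⟩
    have h1 := hu φ M fun j hj => hM j (hj.trans (le_max_left _ _))
    have h2 := hv φ M fun j hj => hM j (hj.trans (le_max_right _ _))
    calc ‖(u + v) φ‖ ≤ ‖u φ‖ + ‖v φ‖ := norm_add_le _ _
      _ ≤ (C + C') * M := by linarith
  smul_mem' := by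
    rintro c u ⟨N, C, hC, hu⟩
    refine ⟨N, ‖c‖ * C, mul_nonneg (norm_nonneg _) hC, fun φ M hM => ?_⟩
    have h1 := hu φ M hM
    calc ‖(c • u) φ‖ = ‖c‖ * ‖u φ‖ := by simp
      _ ≤ ‖c‖ * (C * M) := by gcongr
      _ = ‖c‖ * C * M := by ring

/-- The type of distributions on the unit circle. -/
abbrev CircleDist : Type := circleDistributions

/-- The complex conjugate of a test function. -/
def conjTest (φ : circleTest) : circleTest :=
  ⟨fun θ => (starRingEnd ℂ) ((φ : ℝ → ℂ) θ),
    (Complex.conjCLE.contDiff).comp φ.2.1, fun θ => congrArg (starRingEnd ℂ) (φ.2.2 θ)⟩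

theorem iteratedDeriv_conjTest (φ : circleTest) (j : ℕ) (θ : ℝ) :
    iteratedDeriv j (conjTest φ : ℝ → ℂ) θ
      = (starRingEnd ℂ) (iteratedDeriv j (φ : ℝ → ℂ) θ) := by
  have h : (conjTest φ : ℝ → ℂ) = fun θ => Complex.conjCLE ((φ : ℝ → ℂ) θ) := rfl
  induction j generalizing θ with
  | zero => simp [h]
  | succ j ih =>
    rw [iteratedDeriv_succ, iteratedDeriv_succ]
    have hd : DifferentiableAt ℝ (iteratedDeriv j (φ : ℝ → ℂ)) θ :=
      (φ.2.1.differentiable_iteratedDeriv j (by exact_mod_cast ENat.natCast_lt_top j)) θ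
    rw [funext ih]
    exact (Complex.conjCLE.toContinuousLinearMap.hasFDerivAt.comp_hasDerivAt θ
      hd.hasDerivAt).deriv

/-- The conjugate distribution, `⟨ū, φ⟩ = conj ⟨u, φ̄⟩`. -/
def distConj (u : CircleDist) : CircleDist :=
  ⟨{ toFun := fun φ => (starRingEnd ℂ) (u.1 (conjTest φ))
     map_add' := fun φ ψ => by
      have : conjTest (φ + ψ) = conjTest φ + conjTest ψ := by
        apply Subtype.ext; funext θ; simp [conjTest]
      rw [this, map_add, map_add]
     map_smul' := fun c φ => by
      have : conjTest (c • φ) = (starRingEnd ℂ) c • conjTest φ := by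
        apply Subtype.ext; funext θ; simp [conjTest]
      rw [this, map_smul]; simp },
   by
    obtain ⟨N, C, hC, hu⟩ := u.2
    refine ⟨N, C, hC, fun φ M hM => ?_⟩
    have h1 := hu (conjTest φ) M fun j hj θ => by
      rw [iteratedDeriv_conjTest, RCLike.norm_conj]; exact hM j hj θ
    simpa using h1⟩

/-- The real part `(u + ū)/2` of a distribution. -/
def distRe (u : CircleDist) : CircleDist := (1 / 2 : ℂ) • (u + distConj u)

/-- The imaginary part `(u - ū)/(2i)` of a distribution. -/
def distIm (u : CircleDist) : CircleDist := (1 / (2 * Complex.I)) • (u - distConj u)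

/-- The product `a u` of a distribution and a smooth function, `⟨a u, φ⟩ = ⟨u, a φ⟩`. -/
def distMul (a : circleTest) (u : CircleDist) : CircleDist :=
  ⟨u.1 ∘ₗ LinearMap.mulLeft ℂ a, by
    obtain ⟨N, C, hC, hu⟩ := u.2
    obtain ⟨A, hA0, hA⟩ := circleTest_bounded a N
    refine ⟨N, C * (2 ^ N * A), by positivity, fun φ M hM => ?_⟩
    have hM0 : 0 ≤ M := (norm_nonneg _).trans (hM 0 (Nat.zero_le _) 0)
    have h1 := hu (a * φ) (2 ^ N * A * M) fun j hj θ => by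
      have e : ((a * φ : circleTest) : ℝ → ℂ) = (a : ℝ → ℂ) * (φ : ℝ → ℂ) := rfl
      have ha : ContDiffAt ℝ j (a : ℝ → ℂ) θ :=
        (a.2.1.of_le (by exact_mod_cast le_top)).contDiffAt
      have hφ : ContDiffAt ℝ j (φ : ℝ → ℂ) θ :=
        (φ.2.1.of_le (by exact_mod_cast le_top)).contDiffAt
      rw [e, iteratedDeriv_mul ha hφ]
      calc ‖∑ i ∈ Finset.range (j + 1), (j.choose i : ℂ) * iteratedDeriv i (a : ℝ → ℂ) θ
              * iteratedDeriv (j - i) (φ : ℝ → ℂ) θ‖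
          ≤ ∑ i ∈ Finset.range (j + 1), (j.choose i : ℝ) * (A * M) := by
            refine norm_sum_le_of_le _ fun i hi => ?_
            have hi' : i ≤ j := Nat.lt_succ_iff.1 (Finset.mem_range.1 hi)
            rw [norm_mul, norm_mul, Complex.norm_natCast, mul_assoc]
            gcongr
            · exact hA i (hi'.trans hj) θ
            · exact hM (j - i) ((Nat.sub_le _ _).trans hj) θ
        _ = 2 ^ j * (A * M) := by
            rw [← Finset.sum_mul]
            congr 1
            exact_mod_cast Nat.sum_range_choose j
        _ ≤ 2 ^ N * (A * M) := by
            have : (2 : ℝ) ^ j ≤ 2 ^ N := pow_le_pow_right₀ (by norm_num) hj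
            gcongr
        _ = 2 ^ N * A * M := by ring
    calc ‖(u.1 ∘ₗ LinearMap.mulLeft ℂ a) φ‖ = ‖u.1 (a * φ)‖ := rfl
      _ ≤ C * (2 ^ N * A * M) := h1
      _ = C * (2 ^ N * A) * M := by ring⟩

/-- The test function `θ ↦ e^{-ikθ}`. -/
def expTest (k : ℕ) : circleTest :=
  ⟨fun θ => Complex.exp (-(Complex.I * k * θ)), by
    constructor
    · exact Complex.contDiff_exp.comp (contDiff_const.mul Complex.ofRealCLM.contDiff).neg
    · intro θ
      rw [Complex.exp_eq_exp_iff_exists_int]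
      exact ⟨-k, by push_cast; ring⟩⟩

open Classical in
/-- The pairing `⟨u, g⟩`, for a function `g` of the angle that is a test function
(and `0`, a value that is never used, if it is not). -/
def distPair (u : CircleDist) (g : ℝ → ℂ) : ℂ :=
  if hg : g ∈ circleTest then u.1 ⟨g, hg⟩ else 0

/-! ## Boundary values, `H_b` and the Hardy spaces -/

/-- The open unit disk `D`. -/
def unitDisk : Set ℂ := Metric.ball 0 1

/-- `u` is the boundary value of `f` in the sense of distributions:
`⟨u, φ⟩ = lim_{r ↗ 1} ∫_0^{2π} f(r e^{iθ}) φ(θ) dθ` for every `φ`. -/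
def IsBoundaryValue (f : ℂ → ℂ) (u : CircleDist) : Prop :=
  ∀ φ : circleTest, Filter.Tendsto
    (fun r : ℝ => ∫ θ in (0 : ℝ)..(2 * Real.pi),
      f (r * Complex.exp (θ * Complex.I)) * (φ : ℝ → ℂ) θ)
    (nhdsWithin 1 (Set.Iio 1)) (nhds (u.1 φ))

/-- `f` has a boundary value in the sense of distributions, i.e. the limits above exist for every
`φ` and define an element of `𝒟'(∂D)`. (For continuous `f` the second requirement follows from
the first by the Banach–Steinhaus theorem.) -/
def HasBoundaryValue (f : ℂ → ℂ) : Prop := ∃ u : CircleDist, IsBoundaryValue f u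

open Classical in
/-- The boundary value `f_b` of `f` (and `0` if `f` has none). -/
def boundaryValue (f : ℂ → ℂ) : CircleDist :=
  if hf : HasBoundaryValue f then hf.choose else 0

theorem HasBoundaryValue.isBoundaryValue {f : ℂ → ℂ} (hf : HasBoundaryValue f) :
    IsBoundaryValue f (boundaryValue f) := by
  rw [boundaryValue, dif_pos hf]; exact hf.choose_spec

theorem IsBoundaryValue.boundaryValue_eq {f : ℂ → ℂ} {u : CircleDist}
    (hu : IsBoundaryValue f u) : boundaryValue f = u := by
  apply Subtype.ext
  apply LinearMap.ext
  intro φ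
  exact tendsto_nhds_unique ((HasBoundaryValue.isBoundaryValue ⟨u, hu⟩) φ) (hu φ)

/-- `H_b`: the holomorphic functions on `D` with a boundary value in the sense of distributions. -/
def Hb : Set (ℂ → ℂ) := {h | DifferentiableOn ℂ h unitDisk ∧ HasBoundaryValue h}

/-- The Hardy space `H^p(D)`, `0 < p < ∞`. -/
def hardySpace (p : ℝ) : Set (ℂ → ℂ) :=
  {f | DifferentiableOn ℂ f unitDisk ∧ ∃ C : ℝ, ∀ r : ℝ, 0 < r → r < 1 →
    ∫ θ in (0 : ℝ)..(2 * Real.pi), ‖f (r * Complex.exp (θ * Complex.I))‖ ^ p ≤ C}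

/-- `Re{(H^p(D))_b}`: the real parts of the boundary values of the functions in `H^p(D)`. -/
def reHardyBoundary (p : ℝ) : Set CircleDist :=
  {u | ∃ H ∈ hardySpace p, HasBoundaryValue H ∧ u = distRe (boundaryValue H)}

/-! ## The Cauchy–Riemann operator and the Schwarz problems -/

/-- The Cauchy–Riemann operator `∂/∂z̄ = (∂/∂x + i ∂/∂y)/2`; its iterates are `dbar^[k]`. -/
def dbar (f : ℂ → ℂ) : ℂ → ℂ :=
  fun z => (1 / 2 : ℂ) * (fderiv ℝ f z 1 + Complex.I * fderiv ℝ f z Complex.I)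

/-- `f` solves on `D` the homogeneous Schwarz problem of order `n`:
`∂ⁿf/∂z̄ⁿ = 0`, `Re{f_b} = Re{(h₀)_b}`, `Re{(∂ᵏf/∂z̄ᵏ)_b} = η_k` for `1 ≤ k ≤ n - 1`, and
`Im{(∂ᵏf/∂z̄ᵏ)(0)} = c_k` for `0 ≤ k ≤ n - 1`. -/
structure SolvesHomogeneousSchwarz (n : ℕ) (h₀ : ℂ → ℂ) (η : ℕ → CircleDist) (c : ℕ → ℝ)
    (f : ℂ → ℂ) : Prop where
  differentiable : ∀ k < n, DifferentiableOn ℝ (dbar^[k] f) unitDisk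
  equation : ∀ z ∈ unitDisk, dbar^[n] f z = 0
  hasBoundaryValue : ∀ k < n, HasBoundaryValue (dbar^[k] f)
  re_boundary_zero : distRe (boundaryValue f) = distRe (boundaryValue h₀)
  re_boundary : ∀ k, 1 ≤ k → k < n → distRe (boundaryValue (dbar^[k] f)) = η k
  im_zero : ∀ k < n, (dbar^[k] f 0).im = c k

/-- `w` solves on `D` the first-order Schwarz problem `∂w/∂z̄ = f`, `Re{w_b} = η`,
`Im{w(0)} = c`. -/
structure SolvesFirstOrderSchwarz (f : ℂ → ℂ) (η : CircleDist) (c : ℝ) (w : ℂ → ℂ) : Prop where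
  differentiable : DifferentiableOn ℝ w unitDisk
  equation : ∀ z ∈ unitDisk, dbar w z = f z
  hasBoundaryValue : HasBoundaryValue w
  re_boundary : distRe (boundaryValue w) = η
  im_zero : (w 0).im = c

/-! ## The explicit solution -/

/-- `P_r(θ) = (1 - r²) / (1 - 2 r cos θ + r²)`. -/
def poissonP (r θ : ℝ) : ℝ := (1 - r ^ 2) / (1 - 2 * r * Real.cos θ + r ^ 2)

/-- `Q_r(θ) = 2 r sin θ / (1 - 2 r cos θ + r²)`. -/
def poissonQ (r θ : ℝ) : ℝ := (2 * r * Real.sin θ) / (1 - 2 * r * Real.cos θ + r ^ 2)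

/-- The function `t ↦ P_r(θ - t)`, where `z = r e^{iθ}`. -/
def poissonTest (z : ℂ) : ℝ → ℂ := fun t => (poissonP ‖z‖ (z.arg - t) : ℂ)

/-- The function `t ↦ (P_r(θ - t) + i Q_r(θ - t)) (e^{it} - z + conj (e^{it} - z))^m`, where
`z = r e^{iθ}`. -/
def schwarzTest (m : ℕ) (z : ℂ) : ℝ → ℂ := fun t =>
  ((poissonP ‖z‖ (z.arg - t) : ℂ) + Complex.I * (poissonQ ‖z‖ (z.arg - t) : ℂ)) *
    ((Complex.exp (t * Complex.I) - z)
      + (starRingEnd ℂ) (Complex.exp (t * Complex.I) - z)) ^ m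

theorem poisson_denom_pos {r : ℝ} (hr0 : 0 ≤ r) (hr : r < 1) (x : ℝ) :
    0 < 1 - 2 * r * Real.cos x + r ^ 2 := by
  nlinarith [Real.cos_le_one x, Real.neg_one_le_cos x, mul_nonneg hr0 (sub_nonneg.2 (Real.cos_le_one x)),
    pow_pos (sub_pos.2 hr) 2]

theorem poissonTest_mem {z : ℂ} (hz : z ∈ unitDisk) : poissonTest z ∈ circleTest := by
  have hr : ‖z‖ < 1 := by simpa [unitDisk] using hz
  constructor
  · refine Complex.ofRealCLM.contDiff.comp ?_
    exact ContDiff.div (by fun_prop) (by fun_prop)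
      fun t => (poisson_denom_pos (norm_nonneg z) hr _).ne'
  · intro t
    simp only [poissonTest, poissonP, ← sub_sub, Real.cos_sub_two_pi]

theorem schwarzTest_mem (m : ℕ) {z : ℂ} (hz : z ∈ unitDisk) :
    schwarzTest m z ∈ circleTest := by
  have hr : ‖z‖ < 1 := by simpa [unitDisk] using hz
  constructor
  · have he : ContDiff ℝ ∞ fun t : ℝ => Complex.exp (t * Complex.I) - z :=
      (Complex.contDiff_exp.comp (Complex.ofRealCLM.contDiff.mul contDiff_const)).sub contDiff_const
    refine ContDiff.mul (ContDiff.add (poissonTest_mem hz).1 (contDiff_const.mul ?_))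
      (ContDiff.pow (he.add (Complex.conjCLE.contDiff.comp he)) m)
    refine Complex.ofRealCLM.contDiff.comp ?_
    exact ContDiff.div (by fun_prop) (by fun_prop)
      fun t => (poisson_denom_pos (norm_nonneg z) hr _).ne'
  · intro t
    have he : Complex.exp (((t + 2 * Real.pi : ℝ) : ℂ) * Complex.I)
        = Complex.exp (t * Complex.I) := by
      rw [Complex.exp_eq_exp_iff_exists_int]
      exact ⟨1, by push_cast; ring⟩
    simp only [schwarzTest, poissonP, poissonQ, ← sub_sub, Real.cos_sub_two_pi,
      Real.sin_sub_two_pi, he]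

/-- `i c - (i/2π) ⟨Im{h_b}, 1⟩ + (1/2π) ⟨h_b, P_r(θ - ·)⟩`, where `z = r e^{iθ}`. -/
def holomorphicPart (h : ℂ → ℂ) (c : ℝ) (z : ℂ) : ℂ :=
  Complex.I * c
    - Complex.I / (2 * Real.pi) * distPair (distIm (boundaryValue h)) (fun _ => 1)
    + 1 / (2 * Real.pi) * distPair (boundaryValue h) (poissonTest z)

/-- The explicit solution of the first-order problem, in terms of the data
`n`, `h₀`, `η_1, …, η_{n-1}`, `c_0, …, c_{n-1}`, `h`, `c`. -/
def schwarzSolution (n : ℕ) (h₀ : ℂ → ℂ) (η : ℕ → CircleDist) (cs : ℕ → ℝ)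
    (h : ℂ → ℂ) (c : ℝ) (z : ℂ) : ℂ :=
  Complex.I * c
    - Complex.I / (2 * Real.pi) * distPair (distIm (boundaryValue h)) (fun _ => 1)
    + 1 / (2 * Real.pi) * distPair (boundaryValue h) (poissonTest z)
    + (starRingEnd ℂ) z *
      (-(Complex.I / (2 * Real.pi) * distPair (distIm (boundaryValue h₀)) (fun _ => 1))
        + 1 / (2 * Real.pi) * distPair (boundaryValue h₀) (poissonTest z))
    - Complex.I * ∑ k ∈ Finset.Icc 1 n, ∑ l ∈ Finset.Icc (k - 1) (n - 1),
        ((-1) ^ k * (cs l : ℂ)) / ((k.factorial : ℂ) * ((l - (k - 1)).factorial : ℂ))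
          * (starRingEnd ℂ) z ^ k * (z + (starRingEnd ℂ) z) ^ (l - (k - 1))
    - ∑ k ∈ Finset.Icc 1 n, ∑ l ∈ Finset.Icc (max 1 (k - 1)) (n - 1),
        (-1) ^ (l + 1) /
            (2 * Real.pi * (k.factorial : ℂ) * ((l - (k - 1)).factorial : ℂ))
          * (starRingEnd ℂ) z ^ k * distPair (η l) (schwarzTest (l - (k - 1)) z)

end

noncomputable section

/-! ## Calculus of the Cauchy–Riemann operator -/

/-! Write `F m` for the m-th ∂/∂z̄-derivative of `f`. If ∂a/∂z̄ = -1, the derivatives of the terms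
aᵐ/m! · F m cancel in pairs (`dbar_taylor_sum`). This telescoping is used with two choices of a.

With a = -(z + z̄), and because the chain ends in 0, the sum is holomorphic. On the circle a becomes
-2cos θ, a real multiplier, so the real part of the sum's boundary value involves only the real
parts of the boundary values of the `F m`. The Schwarz formula, obtained from Cauchy's formula on
dilated circles, then recovers the sum from the data. Doing this for every tail of the chain and
inverting with the binomial theorem gives `f` and its derivatives explicitly
(`IsDbarChain.apply_eq`).

With a = -z̄, the sum over k in the theorem has ∂/∂z̄ equal to -f; subtracting it from a holomorphic
function solves the equation. Boundary values follow because z̄ᵏ is rᵏe^{-ikθ} on the circle of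
radius r, and the value at 0 follows because every term contains z̄. Substituting the explicit
derivatives of `f` gives the stated formula for w (`schwarzSolution_eq`). -/

theorem isOpen_unitDisk : IsOpen unitDisk := Metric.isOpen_ball

theorem mem_unitDisk {z : ℂ} : z ∈ unitDisk ↔ ‖z‖ < 1 := by simp [unitDisk]

theorem zero_mem_unitDisk : (0 : ℂ) ∈ unitDisk := by simp [unitDisk]

theorem DifferentiableOn.differentiableAt_unitDisk {f : ℂ → ℂ} (hf : DifferentiableOn ℝ f unitDisk)
    {z : ℂ} (hz : z ∈ unitDisk) : DifferentiableAt ℝ f z :=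
  hf.differentiableAt (isOpen_unitDisk.mem_nhds hz)

theorem dbar_add {f g : ℂ → ℂ} {z : ℂ} (hf : DifferentiableAt ℝ f z)
    (hg : DifferentiableAt ℝ g z) : dbar (fun w => f w + g w) z = dbar f z + dbar g z := by
  simp only [dbar, fderiv_fun_add hf hg, add_apply]
  ring

theorem dbar_sub {f g : ℂ → ℂ} {z : ℂ} (hf : DifferentiableAt ℝ f z)
    (hg : DifferentiableAt ℝ g z) : dbar (fun w => f w - g w) z = dbar f z - dbar g z := by
  simp only [dbar, fderiv_fun_sub hf hg, sub_apply]
  ring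

theorem dbar_mul {f g : ℂ → ℂ} {z : ℂ} (hf : DifferentiableAt ℝ f z)
    (hg : DifferentiableAt ℝ g z) :
    dbar (fun w => f w * g w) z = f z * dbar g z + g z * dbar f z := by
  simp only [dbar, fderiv_fun_mul hf hg, add_apply,
    smul_apply, smul_eq_mul]
  ring

theorem dbar_const (a z : ℂ) : dbar (fun _ => a) z = 0 := by
  simp [dbar]

theorem dbar_congr {f g : ℂ → ℂ} {z : ℂ} (h : Set.EqOn f g unitDisk) (hz : z ∈ unitDisk) :
    dbar f z = dbar g z := by
  have : f =ᶠ[nhds z] g := h.eventuallyEq_of_mem (isOpen_unitDisk.mem_nhds hz)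
  simp only [dbar, this.fderiv_eq]

theorem dbar_eq_zero {f : ℂ → ℂ} {z : ℂ} (hf : DifferentiableAt ℂ f z) : dbar f z = 0 := by
  have h := (hf.hasFDerivAt.restrictScalars ℝ).fderiv
  have hI : fderiv ℂ f z Complex.I = Complex.I * fderiv ℂ f z 1 := by
    rw [← smul_eq_mul, ← map_smul]; simp
  simp only [dbar, h, ContinuousLinearMap.coe_restrictScalars', hI, ← mul_assoc, Complex.I_mul_I]
  ring

theorem differentiableOn_of_dbar_eq_zero {f : ℂ → ℂ} (hf : DifferentiableOn ℝ f unitDisk)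
    (h : ∀ z ∈ unitDisk, dbar f z = 0) : DifferentiableOn ℂ f unitDisk := fun z hz => by
  refine (differentiableAt_complex_iff_differentiableAt_real.2
    ⟨hf.differentiableAt_unitDisk hz, ?_⟩).differentiableWithinAt
  have h2 := h z hz
  simp only [dbar, mul_eq_zero] at h2
  rw [smul_eq_mul]
  have h3 : fderiv ℝ f z 1 + Complex.I * fderiv ℝ f z Complex.I = 0 :=
    h2.resolve_left (by norm_num)
  -- Multiplying f_x + i f_y = 0 by -i gives the Cauchy–Riemann equation f_y = i f_x.
  linear_combination (-Complex.I) * h3 + (fderiv ℝ f z Complex.I) * Complex.I_mul_I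

theorem dbar_conj (z : ℂ) : dbar (fun w => (starRingEnd ℂ) w) z = 1 := by
  have h : fderiv ℝ (fun w => (starRingEnd ℂ) w) z = Complex.conjCLE.toContinuousLinearMap :=
    Complex.conjCLE.toContinuousLinearMap.hasFDerivAt.fderiv
  simp only [dbar, h]
  simp
  norm_num

theorem differentiable_conj : Differentiable ℝ fun w : ℂ => (starRingEnd ℂ) w :=
  Complex.conjCLE.toContinuousLinearMap.differentiable

/-- Divided powers absorb the constants of the power rule, which is what lets consecutive terms of
the Taylor sums cancel exactly. -/
theorem dbar_pow_succ_div_factorial {a : ℂ → ℂ} {z : ℂ} (ha : DifferentiableAt ℝ a z) (m : ℕ) :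
    dbar (fun w => a w ^ (m + 1) / ((m + 1).factorial : ℂ)) z
      = a z ^ m / (m.factorial : ℂ) * dbar a z := by
  induction m with
  | zero => simp
  | succ m ih =>
    have h2 : (fun w => a w ^ (m + 1 + 1) / ((m + 1 + 1).factorial : ℂ))
        = fun w => (1 / (m + 2 : ℂ) * a w) * (a w ^ (m + 1) / ((m + 1).factorial : ℂ)) := by
      funext w
      rw [Nat.factorial_succ (m + 1)]
      push_cast
      have : (m : ℂ) + 1 + 1 ≠ 0 := by exact_mod_cast (Nat.succ_ne_zero (m + 1))
      have h3 : ((m + 1).factorial : ℂ) ≠ 0 := by exact_mod_cast (Nat.factorial_ne_zero _)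
      have h4 : (m : ℂ) + 2 ≠ 0 := by exact_mod_cast (Nat.succ_ne_zero (m + 1))
      field_simp
      ring
    rw [h2, dbar_mul (by fun_prop) (by fun_prop), dbar_mul (by fun_prop) ha, dbar_const,
      ih]
    rw [Nat.factorial_succ m]
    push_cast
    have h1 : (m : ℂ) + 1 ≠ 0 := by exact_mod_cast (Nat.succ_ne_zero m)
    have h3 : (m.factorial : ℂ) ≠ 0 := by exact_mod_cast (Nat.factorial_ne_zero _)
    have h4 : (m : ℂ) + 2 ≠ 0 := by exact_mod_cast (Nat.succ_ne_zero (m + 1))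
    field_simp
    ring

/-- Telescoping of `∂/∂z̄` on a Taylor type sum whose variable `a` has `∂a/∂z̄ = -1`. -/
theorem dbar_taylor_sum {a : ℂ → ℂ} {F : ℕ → ℂ → ℂ} {z : ℂ} (ha : DifferentiableAt ℝ a z)
    (ha' : dbar a z = -1) (N : ℕ) (hF : ∀ m < N, DifferentiableAt ℝ (F m) z)
    (hF' : ∀ m < N, dbar (F m) z = F (m + 1) z) :
    dbar (fun w => ∑ m ∈ Finset.range N, a w ^ (m + 1) / ((m + 1).factorial : ℂ) * F m w) z
      = a z ^ N / (N.factorial : ℂ) * F N z - F 0 z := by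
  induction N with
  | zero => simp [dbar_const]
  | succ N ih =>
    have hd : ∀ m < N + 1, DifferentiableAt ℝ
        (fun w => a w ^ (m + 1) / ((m + 1).factorial : ℂ) * F m w) z := fun m hm => by
      have := hF m hm
      fun_prop
    have hs : DifferentiableAt ℝ (fun w => ∑ m ∈ Finset.range N,
        a w ^ (m + 1) / ((m + 1).factorial : ℂ) * F m w) z :=
      DifferentiableAt.fun_sum fun m hm => hd m ((Finset.mem_range.1 hm).trans N.lt_succ_self)
    have hFN := hF N N.lt_succ_self
    simp only [Finset.sum_range_succ]
    -- Differentiating the power in the new term cancels the end term left by the induction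
    -- hypothesis; differentiating `F N` produces the next end term.
    rw [dbar_add hs (hd N N.lt_succ_self), ih (fun m hm => hF m (hm.trans N.lt_succ_self))
      (fun m hm => hF' m (hm.trans N.lt_succ_self)), dbar_mul (by fun_prop) hFN,
      dbar_pow_succ_div_factorial ha, ha', hF' N N.lt_succ_self]
    ring

/-! ## Boundary values in the sense of distributions -/

theorem circlePoint_mem {r : ℝ} (h0 : 0 < r) (h1 : r < 1) (θ : ℝ) :
    (r : ℂ) * Complex.exp (θ * Complex.I) ∈ unitDisk := by
  rw [mem_unitDisk, norm_mul, Complex.norm_exp_ofReal_mul_I, Complex.norm_real, mul_one,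
    Real.norm_of_nonneg h0.le]
  exact h1

theorem eventually_radius : ∀ᶠ r : ℝ in nhdsWithin 1 (Set.Iio 1), 0 < r ∧ r < 1 :=
  Ioo_mem_nhdsLT (by norm_num : (0 : ℝ) < 1)

theorem continuous_onCircle {f : ℂ → ℂ} (hf : ContinuousOn f unitDisk) {r : ℝ} (h0 : 0 < r)
    (h1 : r < 1) : Continuous fun θ : ℝ => f (r * Complex.exp (θ * Complex.I)) :=
  hf.comp_continuous (by fun_prop) (circlePoint_mem h0 h1)

theorem continuous_circleTest (φ : circleTest) : Continuous (φ : ℝ → ℂ) := φ.2.1.continuous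

theorem IsBoundaryValue.congr {f g : ℂ → ℂ} {u : CircleDist} (hf : IsBoundaryValue f u)
    (h : Set.EqOn f g unitDisk) : IsBoundaryValue g u := fun φ => by
  refine (hf φ).congr' ?_
  filter_upwards [eventually_radius] with r hr
  simp only [h (circlePoint_mem hr.1 hr.2 _)]

/-- Continuity makes both integrands integrable on each circle, as additivity of the integral
requires. -/
theorem IsBoundaryValue.add {f g : ℂ → ℂ} {u v : CircleDist} (hf : IsBoundaryValue f u)
    (hg : IsBoundaryValue g v) (hfc : ContinuousOn f unitDisk) (hgc : ContinuousOn g unitDisk) :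
    IsBoundaryValue (fun z => f z + g z) (u + v) := fun φ => by
  refine ((hf φ).add (hg φ)).congr' ?_
  filter_upwards [eventually_radius] with r hr
  rw [← intervalIntegral.integral_add]
  · simp only [add_mul]
  · exact ((continuous_onCircle hfc hr.1 hr.2).mul (continuous_circleTest φ)).intervalIntegrable _ _
  · exact ((continuous_onCircle hgc hr.1 hr.2).mul (continuous_circleTest φ)).intervalIntegrable _ _

theorem IsBoundaryValue.const_mul {f : ℂ → ℂ} {u : CircleDist} (hf : IsBoundaryValue f u)
    (a : ℂ) : IsBoundaryValue (fun z => a * f z) (a • u) := fun φ => by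
  refine ((hf φ).const_mul a).congr fun r => ?_
  rw [← intervalIntegral.integral_const_mul]
  simp only [mul_assoc]

theorem isBoundaryValue_zero : IsBoundaryValue (fun _ => 0) 0 := fun φ => by
  simp

theorem IsBoundaryValue.sum {ι : Type*} {s : Finset ι} {f : ι → ℂ → ℂ} {u : ι → CircleDist}
    (hf : ∀ i ∈ s, IsBoundaryValue (f i) (u i)) (hc : ∀ i ∈ s, ContinuousOn (f i) unitDisk) :
    IsBoundaryValue (fun z => ∑ i ∈ s, f i z) (∑ i ∈ s, u i) := by
  classical
  induction s using Finset.induction_on with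
  | empty => simpa using isBoundaryValue_zero
  | insert i s hi ih =>
    simp only [Finset.sum_insert hi]
    exact (hf i (Finset.mem_insert_self _ _)).add
      (ih (fun j hj => hf j (Finset.mem_insert_of_mem hj))
        fun j hj => hc j (Finset.mem_insert_of_mem hj))
      (hc i (Finset.mem_insert_self _ _))
      (continuousOn_finsetSum _ fun j hj => hc j (Finset.mem_insert_of_mem hj))

theorem distMul_apply (a : circleTest) (u : CircleDist) (φ : circleTest) :
    (distMul a u).1 φ = u.1 (a * φ) := rfl

/-- Multiplication by a function which is `r a(θ)` at `re^{iθ}`. -/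
theorem IsBoundaryValue.mul_pow {f b : ℂ → ℂ} {u : CircleDist} {a : circleTest}
    (hf : IsBoundaryValue f u)
    (hb : ∀ r θ : ℝ, b (r * Complex.exp (θ * Complex.I)) = r * (a : ℝ → ℂ) θ) (m : ℕ) :
    IsBoundaryValue (fun z => b z ^ m * f z) (distMul (a ^ m) u) := fun φ => by
  have hr : Filter.Tendsto (fun r : ℝ => (r : ℂ) ^ m) (nhdsWithin 1 (Set.Iio 1)) (nhds 1) := by
    have : Continuous fun r : ℝ => (r : ℂ) ^ m := by fun_prop
    simpa using (this.tendsto 1).mono_left nhdsWithin_le_nhds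
  -- The angular factor moves onto the test function, and the radial factor rᵐ tends to 1.
  have h := hr.mul (hf (a ^ m * φ))
  rw [one_mul] at h
  refine h.congr fun r => ?_
  rw [← intervalIntegral.integral_const_mul]
  congr 1
  funext θ
  have : ((a ^ m * φ : circleTest) : ℝ → ℂ) θ = (a : ℝ → ℂ) θ ^ m * (φ : ℝ → ℂ) θ := rfl
  simp only [hb, this, _root_.mul_pow]
  ring

/-- The circle integrals do not depend on r, so the limit is the integral functional itself, which
has order 0. -/
theorem hasBoundaryValue_const (a : ℂ) : HasBoundaryValue fun _ => a := by
  refine ⟨⟨{ toFun := fun φ => ∫ θ in (0 : ℝ)..(2 * Real.pi), a * (φ : ℝ → ℂ) θ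
             map_add' := fun φ ψ => ?_
             map_smul' := fun c φ => ?_ }, 0, ‖a‖ * (2 * Real.pi), by positivity,
               fun φ M hM => ?_⟩, fun φ => tendsto_const_nhds⟩
  · rw [← intervalIntegral.integral_add]
    · simp [mul_add]
    · exact (continuous_const.mul (continuous_circleTest φ)).intervalIntegrable _ _
    · exact (continuous_const.mul (continuous_circleTest ψ)).intervalIntegrable _ _
  · rw [RingHom.id_apply, smul_eq_mul, ← intervalIntegral.integral_const_mul]
    congr 1
    funext θ
    simp
    ring
  · have := intervalIntegral.norm_integral_le_of_norm_le_const (a := 0) (b := 2 * Real.pi)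
      (f := fun θ => a * (φ : ℝ → ℂ) θ) (C := ‖a‖ * M) fun θ _ => by
        rw [norm_mul]
        gcongr
        simpa using hM 0 le_rfl θ
    rw [sub_zero, abs_of_pos Real.two_pi_pos] at this
    refine this.trans (le_of_eq ?_)
    ring

theorem IsBoundaryValue.conj {f : ℂ → ℂ} {u : CircleDist} (hf : IsBoundaryValue f u) :
    IsBoundaryValue (fun z => (starRingEnd ℂ) (f z)) (distConj u) := fun φ => by
  refine ((Complex.continuous_conj.tendsto _).comp (hf (conjTest φ))).congr fun r => ?_
  rw [Function.comp_apply, ← intervalIntegral.intervalIntegral_conj]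
  simp [conjTest]

theorem IsBoundaryValue.unique {f : ℂ → ℂ} {u v : CircleDist} (hu : IsBoundaryValue f u)
    (hv : IsBoundaryValue f v) : u = v := hu.boundaryValue_eq.symm.trans hv.boundaryValue_eq

/-! ## Conjugates and real parts of distributions -/

theorem dist_ext {u v : CircleDist} (h : ∀ φ, u.1 φ = v.1 φ) : u = v :=
  Subtype.ext (LinearMap.ext h)

theorem distConj_apply (u : CircleDist) (φ : circleTest) :
    (distConj u).1 φ = (starRingEnd ℂ) (u.1 (conjTest φ)) := rfl

theorem distRe_apply (u : CircleDist) (φ : circleTest) :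
    (distRe u).1 φ = 1 / 2 * (u.1 φ + (starRingEnd ℂ) (u.1 (conjTest φ))) := rfl

theorem distIm_apply (u : CircleDist) (φ : circleTest) :
    (distIm u).1 φ = 1 / (2 * Complex.I) * (u.1 φ - (starRingEnd ℂ) (u.1 (conjTest φ))) := rfl

theorem distRe_add (u v : CircleDist) : distRe (u + v) = distRe u + distRe v := by
  refine dist_ext fun φ => ?_
  simp [distRe_apply]
  ring

theorem distRe_zero : distRe 0 = 0 := dist_ext fun φ => by simp [distRe_apply]

theorem distRe_sum {ι : Type*} (s : Finset ι) (u : ι → CircleDist) :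
    distRe (∑ i ∈ s, u i) = ∑ i ∈ s, distRe (u i) := by
  classical
  induction s using Finset.induction_on with
  | empty => simp [distRe_zero]
  | insert i s hi ih => simp only [Finset.sum_insert hi, distRe_add, ih]

theorem distRe_smul (a : ℝ) (u : CircleDist) : distRe ((a : ℂ) • u) = (a : ℂ) • distRe u := by
  refine dist_ext fun φ => ?_
  simp [distRe_apply]
  ring

theorem conjTest_mul (φ ψ : circleTest) : conjTest (φ * ψ) = conjTest φ * conjTest ψ := by
  apply Subtype.ext; funext θ; simp [conjTest]

theorem conjTest_pow (φ : circleTest) (m : ℕ) : conjTest (φ ^ m) = conjTest φ ^ m := by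
  apply Subtype.ext; funext θ; simp [conjTest]

/-- A real multiplier commutes with conjugation. This is why the holomorphic sum is built from z +
z̄, real on the circle, and not from z̄. -/
theorem distRe_distMul {a : circleTest} (ha : conjTest a = a) (u : CircleDist) :
    distRe (distMul a u) = distMul a (distRe u) := by
  refine dist_ext fun φ => ?_
  simp only [distRe_apply, distMul_apply, conjTest_mul, ha]

theorem distRe_boundaryValue_I_mul (a : ℝ) :
    distRe (boundaryValue fun _ => Complex.I * a) = 0 := by
  have h := (hasBoundaryValue_const (Complex.I * a)).isBoundaryValue
  have h2 := h.const_mul (-1)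
  have h3 := h.conj
  have h4 : (fun _ : ℂ => (starRingEnd ℂ) (Complex.I * a)) = fun _ => -1 * (Complex.I * a) := by
    funext; simp
  rw [h4] at h3
  refine dist_ext fun φ => ?_
  have h5 : (distConj (boundaryValue fun _ => Complex.I * a)).1 φ
      = -1 * (boundaryValue fun _ => Complex.I * a).1 φ := by rw [h3.unique h2]; rfl
  rw [distRe_apply, ← distConj_apply, h5]
  simp

theorem distPair_eq (u : CircleDist) {g : ℝ → ℂ} (hg : g ∈ circleTest) :
    distPair u g = u.1 ⟨g, hg⟩ := dif_pos hg

/-! ## The Schwarz kernel -/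

theorem exp_sub_ne_zero {z : ℂ} (hz : z ∈ unitDisk) (t : ℝ) :
    Complex.exp (t * Complex.I) - z ≠ 0 := fun h => by
  have h2 := mem_unitDisk.1 hz
  rw [← sub_eq_zero.1 h, Complex.norm_exp_ofReal_mul_I] at h2
  exact lt_irrefl _ h2

theorem exp_mul_conj_exp (t : ℝ) :
    Complex.exp (t * Complex.I) * (starRingEnd ℂ) (Complex.exp (t * Complex.I)) = 1 := by
  rw [Complex.mul_conj, Complex.normSq_eq_norm_sq, Complex.norm_exp_ofReal_mul_I]
  simp

/-- `P_r(θ - t) + i Q_r(θ - t) = (e^{it} + z) / (e^{it} - z)`. -/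
theorem poissonP_add_poissonQ {z : ℂ} (hz : z ∈ unitDisk) (t : ℝ) :
    (poissonP ‖z‖ (z.arg - t) : ℂ) + Complex.I * (poissonQ ‖z‖ (z.arg - t) : ℂ)
      = (Complex.exp (t * Complex.I) + z) / (Complex.exp (t * Complex.I) - z) := by
  have hD : ((1 - 2 * ‖z‖ * Real.cos (z.arg - t) + ‖z‖ ^ 2 : ℝ) : ℂ) ≠ 0 := by
    exact_mod_cast (poisson_denom_pos (norm_nonneg z) (mem_unitDisk.1 hz) _).ne'
  have he := exp_sub_ne_zero hz t
  have h1 := exp_mul_conj_exp t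
  -- The product z e^{-it} is r e^{i(θ-t)}, whose real and imaginary parts enter P and Q.
  have hk : z * (starRingEnd ℂ) (Complex.exp (t * Complex.I))
      = ‖z‖ * Real.cos (z.arg - t) + ‖z‖ * Real.sin (z.arg - t) * Complex.I := by
    conv_lhs => rw [← Complex.norm_mul_exp_arg_mul_I z]
    rw [← Complex.exp_conj, mul_assoc, ← Complex.exp_add, map_mul, Complex.conj_I,
      Complex.conj_ofReal]
    have : (z.arg : ℂ) * Complex.I + t * -Complex.I = ((z.arg - t : ℝ) : ℂ) * Complex.I := by
      push_cast; ring
    rw [this, Complex.exp_mul_I, ← Complex.ofReal_cos, ← Complex.ofReal_sin]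
    ring
  have hk' : (starRingEnd ℂ) z * Complex.exp (t * Complex.I)
      = ‖z‖ * Real.cos (z.arg - t) - ‖z‖ * Real.sin (z.arg - t) * Complex.I := by
    have := congrArg (starRingEnd ℂ) hk
    simp only [map_mul, map_add, Complex.conj_conj, Complex.conj_ofReal, Complex.conj_I] at this
    rw [this]; ring
  have hz2 : z * (starRingEnd ℂ) z = (‖z‖ : ℂ) ^ 2 := by
    rw [Complex.mul_conj, Complex.normSq_eq_norm_sq]; push_cast; rfl
  rw [poissonP, poissonQ, eq_div_iff he, Complex.ofReal_div, Complex.ofReal_div, mul_div_assoc',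
    ← add_div, div_mul_eq_mul_div, div_eq_iff hD]
  push_cast at hk hk' ⊢
  generalize Complex.cos (z.arg - t) = C at *
  generalize Complex.sin (z.arg - t) = S at *
  generalize Complex.exp (t * Complex.I) = e at *
  generalize (starRingEnd ℂ) e = e' at *
  generalize (starRingEnd ℂ) z = z' at *
  generalize (‖z‖ : ℂ) = ρ at *
  linear_combination (-2 * e) * hk - 2 * z * hk' + 2 * e * hz2 + 2 * z * h1

/-- The Schwarz kernel `t ↦ (e^{it} + z) / (e^{it} - z)` as a test function. -/
def schwarzKernel {z : ℂ} (hz : z ∈ unitDisk) : circleTest := ⟨schwarzTest 0 z, schwarzTest_mem 0 hz⟩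

theorem schwarzKernel_apply {z : ℂ} (hz : z ∈ unitDisk) (t : ℝ) :
    (schwarzKernel hz : ℝ → ℂ) t
      = (Complex.exp (t * Complex.I) + z) / (Complex.exp (t * Complex.I) - z) := by
  rw [← poissonP_add_poissonQ hz]
  simp [schwarzKernel, schwarzTest]

/-- `θ ↦ 2 cos θ`, as a test function. -/
def twoCos : circleTest := expTest 1 + conjTest (expTest 1)

theorem conjTest_twoCos : conjTest twoCos = twoCos := by
  apply Subtype.ext; funext θ
  simp [conjTest, twoCos, add_comm]

theorem conj_exp_mul_I (t : ℝ) :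
    (starRingEnd ℂ) (Complex.exp (t * Complex.I)) = Complex.exp (-(t * Complex.I)) := by
  rw [← Complex.exp_conj]; simp

theorem twoCos_apply (t : ℝ) : (twoCos : ℝ → ℂ) t
    = Complex.exp (t * Complex.I) + (starRingEnd ℂ) (Complex.exp (t * Complex.I)) := by
  have h : (twoCos : ℝ → ℂ) t = Complex.exp (-(Complex.I * (1 : ℕ) * t))
      + (starRingEnd ℂ) (Complex.exp (-(Complex.I * (1 : ℕ) * t))) := rfl
  have h2 : -(Complex.I * (1 : ℕ) * t) = -(t * Complex.I) := by push_cast; ring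
  rw [h, h2, ← conj_exp_mul_I, Complex.conj_conj, add_comm]

theorem expTest_apply (k : ℕ) (t : ℝ) : (expTest k : ℝ → ℂ) t
    = (starRingEnd ℂ) (Complex.exp (t * Complex.I)) ^ k := by
  rw [conj_exp_mul_I, ← Complex.exp_nat_mul]
  have h : (expTest k : ℝ → ℂ) t = Complex.exp (-(Complex.I * k * t)) := rfl
  rw [h]
  congr 1
  ring

theorem expTest_eq_pow (k : ℕ) : expTest k = expTest 1 ^ k := by
  apply Subtype.ext; funext t
  have h : ((expTest 1 ^ k : circleTest) : ℝ → ℂ) t = (expTest 1 : ℝ → ℂ) t ^ k := rfl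
  rw [h, expTest_apply, expTest_apply, pow_one]

/-- Factoring inside the ring of test functions makes the binomial theorem applicable to the
kernels. -/
theorem schwarzTest_eq (m : ℕ) {z : ℂ} (hz : z ∈ unitDisk) :
    (⟨schwarzTest m z, schwarzTest_mem m hz⟩ : circleTest)
      = schwarzKernel hz * (twoCos - algebraMap ℂ circleTest (z + (starRingEnd ℂ) z)) ^ m := by
  apply Subtype.ext; funext t
  have h : ((schwarzKernel hz * (twoCos - algebraMap ℂ circleTest (z + (starRingEnd ℂ) z)) ^ m :
      circleTest) : ℝ → ℂ) t
      = (schwarzKernel hz : ℝ → ℂ) t * ((twoCos : ℝ → ℂ) t - (z + (starRingEnd ℂ) z)) ^ m := rfl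
  rw [h, schwarzKernel_apply, ← poissonP_add_poissonQ hz, twoCos_apply]
  simp only [schwarzTest, map_sub]
  congr 2
  ring

theorem poissonTest_eq {z : ℂ} (hz : z ∈ unitDisk) :
    (⟨poissonTest z, poissonTest_mem hz⟩ : circleTest)
      = (1 / 2 : ℂ) • (schwarzKernel hz + conjTest (schwarzKernel hz)) := by
  apply Subtype.ext; funext t
  have h : (((1 / 2 : ℂ) • (schwarzKernel hz + conjTest (schwarzKernel hz)) : circleTest) :
      ℝ → ℂ) t = 1 / 2 * ((schwarzKernel hz : ℝ → ℂ) t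
        + (starRingEnd ℂ) ((schwarzKernel hz : ℝ → ℂ) t)) := rfl
  rw [h, schwarzKernel_apply, ← poissonP_add_poissonQ hz]
  simp only [poissonTest, map_add, map_mul, Complex.conj_I, Complex.conj_ofReal]
  ring

/-! ## The Schwarz formula for holomorphic functions with boundary values -/

/-- Cauchy's formula on the unit circle. -/
theorem integral_mul_cauchy_kernel {G : ℂ → ℂ} (hG : DifferentiableOn ℂ G (Metric.closedBall 0 1))
    {z : ℂ} (hz : z ∈ unitDisk) :
    ∫ t in (0 : ℝ)..(2 * Real.pi), G (Complex.exp (t * Complex.I)) *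
      (Complex.exp (t * Complex.I) / (Complex.exp (t * Complex.I) - z)) = 2 * Real.pi * G z := by
  have h := hG.circleIntegral_sub_inv_smul hz
  rw [circleIntegral] at h
  simp only [deriv_circleMap, circleMap, smul_eq_mul, zero_add, Complex.ofReal_one, one_mul] at h
  have h2 : ∀ t : ℝ, Complex.exp (t * Complex.I) * Complex.I *
      ((Complex.exp (t * Complex.I) - z)⁻¹ * G (Complex.exp (t * Complex.I)))
      = Complex.I * (G (Complex.exp (t * Complex.I)) *
      (Complex.exp (t * Complex.I) / (Complex.exp (t * Complex.I) - z))) := fun t => by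
    rw [div_eq_mul_inv]; ring
  simp only [h2] at h
  rw [intervalIntegral.integral_const_mul] at h
  apply mul_left_cancel₀ Complex.I_ne_zero
  rw [h]
  ring

theorem integral_mul_one {G : ℂ → ℂ} (hG : DifferentiableOn ℂ G (Metric.closedBall 0 1)) :
    ∫ t in (0 : ℝ)..(2 * Real.pi), G (Complex.exp (t * Complex.I)) = 2 * Real.pi * G 0 := by
  rw [← integral_mul_cauchy_kernel hG zero_mem_unitDisk]
  simp

/-- Dilation gives holomorphy up to the unit circle, so Cauchy's formula applies without boundary
regularity of `g`. -/
theorem differentiableOn_dilate {g : ℂ → ℂ} (hg : DifferentiableOn ℂ g unitDisk) {r : ℝ}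
    (h0 : 0 < r) (h1 : r < 1) :
    DifferentiableOn ℂ (fun ζ => g (r * ζ)) (Metric.closedBall 0 1) := by
  refine hg.comp (by fun_prop) fun ζ hζ => ?_
  have : ‖ζ‖ ≤ 1 := by simpa using hζ
  rw [mem_unitDisk, norm_mul, Complex.norm_real, Real.norm_of_nonneg h0.le]
  nlinarith

/-- With ζ = e^{it}, (ζ + z)/(ζ - z) = 2ζ/(ζ - z) - 1: twice the Cauchy kernel minus the mean value.
-/
theorem integral_mul_schwarzKernel {g : ℂ → ℂ} (hg : DifferentiableOn ℂ g unitDisk) {r : ℝ}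
    (h0 : 0 < r) (h1 : r < 1) {z : ℂ} (hz : z ∈ unitDisk) :
    ∫ t in (0 : ℝ)..(2 * Real.pi), g (r * Complex.exp (t * Complex.I)) *
      (schwarzKernel hz : ℝ → ℂ) t = 2 * Real.pi * (2 * g (r * z) - g 0) := by
  have hd := differentiableOn_dilate hg h0 h1
  have hc : Continuous fun t : ℝ => g (r * Complex.exp (t * Complex.I)) :=
    continuous_onCircle hg.continuousOn h0 h1
  have e : ∀ t : ℝ, g (r * Complex.exp (t * Complex.I)) * (schwarzKernel hz : ℝ → ℂ) t
      = 2 * (g (r * Complex.exp (t * Complex.I)) *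
        (Complex.exp (t * Complex.I) / (Complex.exp (t * Complex.I) - z)))
        - g (r * Complex.exp (t * Complex.I)) := fun t => by
    rw [schwarzKernel_apply]
    have := exp_sub_ne_zero hz t
    field_simp
    ring
  have hk : Continuous fun t : ℝ =>
      Complex.exp (t * Complex.I) / (Complex.exp (t * Complex.I) - z) :=
    Continuous.div (by fun_prop) (by fun_prop) (exp_sub_ne_zero hz)
  simp only [e]
  rw [intervalIntegral.integral_sub, intervalIntegral.integral_const_mul,
    integral_mul_cauchy_kernel hd hz, integral_mul_one hd]
  · simp
    ring
  · exact (continuous_const.mul (hc.mul hk)).intervalIntegrable _ _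
  · exact hc.intervalIntegrable _ _

/-- On the circle the conjugate kernel is (1 + z̄ζ)/(1 - z̄ζ), holomorphic on the closed disk and
equal to 1 at 0, so the mean value property suffices. -/
theorem integral_mul_conj_schwarzKernel {g : ℂ → ℂ} (hg : DifferentiableOn ℂ g unitDisk) {r : ℝ}
    (h0 : 0 < r) (h1 : r < 1) {z : ℂ} (hz : z ∈ unitDisk) :
    ∫ t in (0 : ℝ)..(2 * Real.pi), g (r * Complex.exp (t * Complex.I)) *
      (conjTest (schwarzKernel hz) : ℝ → ℂ) t = 2 * Real.pi * g 0 := by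
  have hne : ∀ ζ ∈ Metric.closedBall (0 : ℂ) 1, 1 - (starRingEnd ℂ) z * ζ ≠ 0 := fun ζ hζ h => by
    have h2 : ‖ζ‖ ≤ 1 := by simpa using hζ
    have h3 : ‖(starRingEnd ℂ) z * ζ‖ = 1 := by rw [← sub_eq_zero.1 h, norm_one]
    rw [norm_mul, RCLike.norm_conj] at h3
    nlinarith [mem_unitDisk.1 hz, norm_nonneg z, norm_nonneg ζ]
  have hd : DifferentiableOn ℂ (fun ζ => g (r * ζ) *
      ((1 + (starRingEnd ℂ) z * ζ) / (1 - (starRingEnd ℂ) z * ζ))) (Metric.closedBall 0 1) :=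
    (differentiableOn_dilate hg h0 h1).mul (DifferentiableOn.div (by fun_prop) (by fun_prop) hne)
  have h := integral_mul_one hd
  simp only [mul_zero, add_zero, sub_zero, div_one, mul_one] at h
  rw [← h]
  congr 1
  funext t
  have h2 : (conjTest (schwarzKernel hz) : ℝ → ℂ) t
      = (starRingEnd ℂ) ((schwarzKernel hz : ℝ → ℂ) t) := rfl
  rw [h2, schwarzKernel_apply, map_div₀, map_add, map_sub]
  congr 1
  have h3 := exp_mul_conj_exp t
  have h4 : (starRingEnd ℂ) (Complex.exp (t * Complex.I)) - (starRingEnd ℂ) z ≠ 0 := by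
    rw [← map_sub]
    exact (map_ne_zero _).2 (exp_sub_ne_zero hz t)
  rw [div_eq_div_iff h4 (hne _ (by simp [Complex.norm_exp_ofReal_mul_I]))]
  linear_combination (-2 * (starRingEnd ℂ) z) * h3

variable {g : ℂ → ℂ} {u : CircleDist}

theorem IsBoundaryValue.apply_schwarzKernel (hu : IsBoundaryValue g u)
    (hg : DifferentiableOn ℂ g unitDisk) {z : ℂ} (hz : z ∈ unitDisk) :
    u.1 (schwarzKernel hz) = 2 * Real.pi * (2 * g z - g 0) := by
  refine tendsto_nhds_unique (hu (schwarzKernel hz)) ?_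
  have hc : ContinuousAt g z := hg.continuousOn.continuousAt (isOpen_unitDisk.mem_nhds hz)
  have hr : Filter.Tendsto (fun r : ℝ => (r : ℂ) * z) (nhdsWithin 1 (Set.Iio 1)) (nhds z) := by
    have : Continuous fun r : ℝ => (r : ℂ) * z := by fun_prop
    simpa using (this.tendsto 1).mono_left nhdsWithin_le_nhds
  refine ((((hc.tendsto.comp hr).const_mul 2).sub_const (g 0)).const_mul
    (2 * Real.pi : ℂ)).congr' ?_
  filter_upwards [eventually_radius] with r hr
  rw [integral_mul_schwarzKernel hg hr.1 hr.2 hz, Function.comp_apply]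

theorem IsBoundaryValue.apply_conj_schwarzKernel (hu : IsBoundaryValue g u)
    (hg : DifferentiableOn ℂ g unitDisk) {z : ℂ} (hz : z ∈ unitDisk) :
    u.1 (conjTest (schwarzKernel hz)) = 2 * Real.pi * g 0 := by
  refine tendsto_nhds_unique (hu _) (tendsto_const_nhds.congr' ?_)
  filter_upwards [eventually_radius] with r hr
  rw [integral_mul_conj_schwarzKernel hg hr.1 hr.2 hz]

theorem schwarzKernel_zero : schwarzKernel zero_mem_unitDisk = 1 := by
  apply Subtype.ext; funext t
  rw [schwarzKernel_apply]
  simp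

theorem IsBoundaryValue.apply_one (hu : IsBoundaryValue g u)
    (hg : DifferentiableOn ℂ g unitDisk) : u.1 1 = 2 * Real.pi * g 0 := by
  rw [← schwarzKernel_zero, hu.apply_schwarzKernel hg]
  ring

/-- The Poisson formula. -/
theorem IsBoundaryValue.distPair_poissonTest (hu : IsBoundaryValue g u)
    (hg : DifferentiableOn ℂ g unitDisk) {z : ℂ} (hz : z ∈ unitDisk) :
    distPair u (poissonTest z) = 2 * Real.pi * g z := by
  rw [distPair_eq u (poissonTest_mem hz), poissonTest_eq hz, map_smul, map_add,
    hu.apply_schwarzKernel hg hz, hu.apply_conj_schwarzKernel hg hz, smul_eq_mul]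
  ring

theorem IsBoundaryValue.distPair_distIm_one (hu : IsBoundaryValue g u)
    (hg : DifferentiableOn ℂ g unitDisk) :
    distPair (distIm u) (fun _ => 1) = 2 * Real.pi * (g 0).im := by
  have hm : (fun _ : ℝ => (1 : ℂ)) ∈ circleTest := (1 : circleTest).2
  have h : (⟨fun _ => 1, hm⟩ : circleTest) = 1 := rfl
  have h1 : conjTest 1 = 1 := by apply Subtype.ext; funext t; simp [conjTest]
  rw [distPair_eq (distIm u) hm, h, distIm_apply, h1, hu.apply_one hg]
  simp only [map_mul, Complex.conj_ofReal, map_ofNat, ← mul_sub, Complex.sub_conj]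
  field_simp
  push_cast
  ring

/-- The Schwarz formula: `g` in terms of the real part of its boundary value. -/
theorem IsBoundaryValue.schwarz_formula (hu : IsBoundaryValue g u)
    (hg : DifferentiableOn ℂ g unitDisk) {z : ℂ} (hz : z ∈ unitDisk) :
    g z = Complex.I * (g 0).im + 1 / (2 * Real.pi) * (distRe u).1 (schwarzKernel hz) := by
  have hpi : (Real.pi : ℂ) ≠ 0 := by exact_mod_cast Real.pi_ne_zero
  -- Up to the factor π, the two halves of the real part give 2g(z) - g(0) and the conjugate of
  -- g(0); their sum is 2(g(z) - i Im g(0)).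
  rw [distRe_apply, hu.apply_schwarzKernel hg, hu.apply_conj_schwarzKernel hg]
  simp only [map_mul, Complex.conj_ofReal, map_ofNat]
  have h := Complex.sub_conj (g 0)
  push_cast at h
  field_simp
  linear_combination h

/-! ## Binomial inversion -/

/-- Stated over a ℂ-algebra because it serves both complex numbers and test functions. -/
theorem add_pow_div_factorial {A : Type*} [CommRing A] [Algebra ℂ A] (x y : A) (M : ℕ) :
    (1 / (M.factorial : ℂ)) • (x + y) ^ M = ∑ k ∈ Finset.range (M + 1),
      (1 / ((k.factorial : ℂ) * ((M - k).factorial : ℂ))) • (x ^ k * y ^ (M - k)) := by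
  rw [add_pow, Finset.smul_sum]
  refine Finset.sum_congr rfl fun k hk => ?_
  have hk' : k ≤ M := Nat.lt_succ_iff.1 (Finset.mem_range.1 hk)
  have h1 : (M.factorial : ℂ) ≠ 0 := by exact_mod_cast M.factorial_ne_zero
  have h2 : (x ^ k * y ^ (M - k)) * (M.choose k : A)
      = (M.choose k : ℂ) • (x ^ k * y ^ (M - k)) := by
    rw [Algebra.smul_def, map_natCast, mul_comm]
  rw [h2, smul_smul, Nat.cast_choose ℂ hk']
  congr 1
  field_simp

/-- Grouping by M = m + j turns the double sum into binomial expansions. For y = -x only the term `F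
0` survives, which inverts the Taylor sums. -/
theorem sum_taylor_shift (x y : ℂ) (F : ℕ → ℂ) (N : ℕ) :
    ∑ m ∈ Finset.range N, x ^ m / (m.factorial : ℂ) *
      ∑ j ∈ Finset.range (N - m), y ^ j / (j.factorial : ℂ) * F (m + j)
      = ∑ m ∈ Finset.range N, (x + y) ^ m / (m.factorial : ℂ) * F m := by
  simp only [Finset.mul_sum]
  rw [← Finset.sum_range_diag_flip N fun m j =>
    x ^ m / (m.factorial : ℂ) * (y ^ j / (j.factorial : ℂ) * F (m + j))]
  refine Finset.sum_congr rfl fun M _ => ?_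
  have h := add_pow_div_factorial x y M
  simp only [smul_eq_mul] at h
  rw [div_eq_mul_one_div, mul_comm ((x + y) ^ M), h, Finset.sum_mul]
  refine Finset.sum_congr rfl fun k hk => ?_
  rw [Nat.add_sub_cancel' (Nat.lt_succ_iff.1 (Finset.mem_range.1 hk))]
  have h1 : (k.factorial : ℂ) ≠ 0 := by exact_mod_cast k.factorial_ne_zero
  have h2 : ((M - k).factorial : ℂ) ≠ 0 := by exact_mod_cast (M - k).factorial_ne_zero
  field_simp

/-- The same regrouping with y under the pairing; linearity brings the powers of the scalar x
inside. -/
theorem sum_taylor_shift_dist (x : ℂ) (y S : circleTest) (U : ℕ → CircleDist) (N : ℕ) :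
    ∑ m ∈ Finset.range N, x ^ m / (m.factorial : ℂ) *
      ∑ j ∈ Finset.range (N - m), 1 / (j.factorial : ℂ) * (U (m + j)).1 (y ^ j * S)
      = ∑ m ∈ Finset.range N,
        1 / (m.factorial : ℂ) * (U m).1 (S * (algebraMap ℂ circleTest x + y) ^ m) := by
  simp only [Finset.mul_sum]
  rw [← Finset.sum_range_diag_flip N fun m j =>
    x ^ m / (m.factorial : ℂ) * (1 / (j.factorial : ℂ) * (U (m + j)).1 (y ^ j * S))]
  refine Finset.sum_congr rfl fun M _ => ?_
  have h := add_pow_div_factorial (algebraMap ℂ circleTest x) y M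
  rw [← smul_eq_mul, ← map_smul, ← mul_smul_comm, h, Finset.mul_sum, map_sum]
  refine Finset.sum_congr rfl fun k hk => ?_
  rw [Nat.add_sub_cancel' (Nat.lt_succ_iff.1 (Finset.mem_range.1 hk))]
  have h3 : S * (1 / ((k.factorial : ℂ) * ((M - k).factorial : ℂ))) •
      (algebraMap ℂ circleTest x ^ k * y ^ (M - k))
      = (x ^ k / (k.factorial : ℂ) * (1 / ((M - k).factorial : ℂ))) • (y ^ (M - k) * S) := by
    rw [← map_pow, ← Algebra.smul_def, smul_smul, mul_smul_comm, mul_comm S]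
    congr 1
    have h1 : (k.factorial : ℂ) ≠ 0 := by exact_mod_cast k.factorial_ne_zero
    have h2 : ((M - k).factorial : ℂ) ≠ 0 := by exact_mod_cast (M - k).factorial_ne_zero
    field_simp
  rw [h3, map_smul, smul_eq_mul, mul_assoc]

/-! ## Representation of polyanalytic functions -/

/-- A finite chain `F 0, …, F (N - 1)` of successive `∂/∂z̄`-derivatives on the disk ending in `0`,
with boundary values `u 0, …, u (N - 1)`. -/
structure IsDbarChain (N : ℕ) (F : ℕ → ℂ → ℂ) (u : ℕ → CircleDist) : Prop where
  differentiable : ∀ m < N, DifferentiableOn ℝ (F m) unitDisk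
  dbar_eq : ∀ m < N, ∀ z ∈ unitDisk, dbar (F m) z = F (m + 1) z
  eq_zero : ∀ z ∈ unitDisk, F N z = 0
  isBoundaryValue : ∀ m < N, IsBoundaryValue (F m) (u m)

/-- The sum `∑ m < N, (-(z + z̄))^m / m! * F m z`, holomorphic if `F` is an `IsDbarChain`. -/
def taylorSum (N : ℕ) (F : ℕ → ℂ → ℂ) (z : ℂ) : ℂ :=
  ∑ m ∈ Finset.range N, (-(z + (starRingEnd ℂ) z)) ^ m / (m.factorial : ℂ) * F m z

namespace IsDbarChain

variable {N : ℕ} {F : ℕ → ℂ → ℂ} {u : ℕ → CircleDist}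

theorem shift (hF : IsDbarChain N F u) {k : ℕ} (hk : k ≤ N) :
    IsDbarChain (N - k) (fun m => F (k + m)) (fun m => u (k + m)) where
  differentiable m hm := hF.differentiable _ (by omega)
  dbar_eq m hm z hz := hF.dbar_eq _ (by omega) z hz
  eq_zero z hz := by rw [Nat.add_sub_cancel' hk]; exact hF.eq_zero z hz
  isBoundaryValue m hm := hF.isBoundaryValue _ (by omega)

theorem differentiableOn_taylorSum (hF : IsDbarChain N F u) :
    DifferentiableOn ℂ (taylorSum N F) unitDisk := by
  have hconj := differentiable_conj
  refine differentiableOn_of_dbar_eq_zero ?_ fun z hz => ?_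
  · refine DifferentiableOn.fun_sum fun m hm => DifferentiableOn.mul ?_
      (hF.differentiable m (Finset.mem_range.1 hm))
    exact Differentiable.differentiableOn (by fun_prop)
  · rcases N with _ | M
    · have e : taylorSum 0 F = fun _ => 0 := by funext w; simp [taylorSum]
      rw [e, dbar_const]
    have ha : DifferentiableAt ℝ (fun w : ℂ => -(w + (starRingEnd ℂ) w)) z := by
      have := hconj z
      fun_prop
    have ha' : dbar (fun w : ℂ => -(w + (starRingEnd ℂ) w)) z = -1 := by
      have e : (fun w : ℂ => -(w + (starRingEnd ℂ) w))
          = fun w => -1 * (w + (starRingEnd ℂ) w) := by funext w; ring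
      have hw : dbar (fun w => w) z = 0 := dbar_eq_zero differentiableAt_fun_id
      rw [e, dbar_mul (by fun_prop) (by have := hconj z; fun_prop), dbar_const,
        dbar_add differentiableAt_fun_id (hconj z), dbar_conj, hw]
      ring
    -- The telescoped terms with m ≥ 1 leave -F 1, which the derivative of the separate term `F 0`
    -- cancels; the other end vanishes with the chain.
    have h := dbar_taylor_sum (F := fun m => F (m + 1)) ha ha' M
      (fun m hm => (hF.differentiable (m + 1) (by omega)).differentiableAt_unitDisk hz)
      (fun m hm => hF.dbar_eq (m + 1) (by omega) z hz)
    have e : taylorSum (M + 1) F = fun w => (∑ m ∈ Finset.range M,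
        (-(w + (starRingEnd ℂ) w)) ^ (m + 1) / ((m + 1).factorial : ℂ) * F (m + 1) w) + F 0 w := by
      funext w
      simp [taylorSum, Finset.sum_range_succ']
    have h0 := (hF.differentiable 0 M.succ_pos).differentiableAt_unitDisk hz
    rw [e, dbar_add _ h0, h, hF.eq_zero z hz, hF.dbar_eq 0 M.succ_pos z hz]
    · ring
    · refine DifferentiableAt.fun_sum fun m hm => ?_
      have := (hF.differentiable (m + 1)
        (Nat.succ_lt_succ (Finset.mem_range.1 hm))).differentiableAt_unitDisk hz
      fun_prop

theorem isBoundaryValue_taylorSum (hF : IsDbarChain N F u) :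
    IsBoundaryValue (taylorSum N F) (∑ m ∈ Finset.range N,
      (1 / (m.factorial : ℂ)) • distMul ((-twoCos) ^ m) (u m)) := by
  have hconj := differentiable_conj
  have hb : ∀ r θ : ℝ, -((r : ℂ) * Complex.exp (θ * Complex.I)
      + (starRingEnd ℂ) (r * Complex.exp (θ * Complex.I))) = r * ((-twoCos : circleTest) : ℝ → ℂ) θ
      := fun r θ => by
    have : ((-twoCos : circleTest) : ℝ → ℂ) θ = -(twoCos : ℝ → ℂ) θ := rfl
    rw [this, twoCos_apply, map_mul, Complex.conj_ofReal]
    ring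
  have e : taylorSum N F = fun z => ∑ m ∈ Finset.range N,
      (1 / (m.factorial : ℂ)) * ((-(z + (starRingEnd ℂ) z)) ^ m * F m z) := by
    funext z
    refine Finset.sum_congr rfl fun m _ => ?_
    ring
  rw [e]
  refine IsBoundaryValue.sum (fun m hm => ?_) fun m hm => ?_
  · exact ((hF.isBoundaryValue m (Finset.mem_range.1 hm)).mul_pow
      (b := fun z => -(z + (starRingEnd ℂ) z)) hb m).const_mul _
  · refine continuousOn_const.mul (ContinuousOn.mul ?_
      (hF.differentiable m (Finset.mem_range.1 hm)).continuousOn)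
    exact Continuous.continuousOn (by have := hconj.continuous; fun_prop)

/-- This is the Schwarz formula for the holomorphic sum: at 0 only the term m = 0 remains, and the
real multipliers (-2cos θ)ᵐ pass through the real part. -/
theorem taylorSum_eq (hF : IsDbarChain N F u) (hN : 0 < N) {z : ℂ} (hz : z ∈ unitDisk) :
    taylorSum N F z = Complex.I * (F 0 0).im + 1 / (2 * Real.pi) * ∑ m ∈ Finset.range N,
      1 / (m.factorial : ℂ) * (distRe (u m)).1 ((-twoCos) ^ m * schwarzKernel hz) := by
  obtain ⟨M, rfl⟩ := Nat.exists_eq_succ_of_ne_zero hN.ne'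
  have h0 : taylorSum (M + 1) F 0 = F 0 0 := by
    simp [taylorSum, Finset.sum_range_succ']
  rw [hF.isBoundaryValue_taylorSum.schwarz_formula hF.differentiableOn_taylorSum hz, h0]
  congr 2
  have hX : ∀ m : ℕ, conjTest ((-twoCos) ^ m) = (-twoCos) ^ m := fun m => by
    rw [conjTest_pow]
    congr 1
    apply Subtype.ext; funext t
    have := congrArg (fun φ : circleTest => -(φ : ℝ → ℂ) t) conjTest_twoCos
    simpa [conjTest] using this
  have hs : ∀ m : ℕ, (1 / (m.factorial : ℂ)) = ((1 / m.factorial : ℝ) : ℂ) := fun m => by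
    push_cast; rfl
  rw [distRe_sum]
  simp only [hs, distRe_smul, distRe_distMul (hX _)]
  rw [Submodule.coe_sum, LinearMap.sum_apply]
  rfl

/-- Weighting the holomorphic sums of all tails by (z + z̄)ᵐ/m! recovers `F 0`. On the data side the
same weights combine with -2cos t to give the powers in the kernels. -/
theorem apply_eq (hF : IsDbarChain N F u) (hN : 0 < N) {z : ℂ} (hz : z ∈ unitDisk) :
    F 0 z = ∑ m ∈ Finset.range N, (Complex.I * (F m 0).im *
        (z + (starRingEnd ℂ) z) ^ m / (m.factorial : ℂ)
      + (-1) ^ m / (2 * Real.pi * (m.factorial : ℂ)) *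
        distPair (distRe (u m)) (schwarzTest m z)) := by
  have h1 : ∑ m ∈ Finset.range N, (z + (starRingEnd ℂ) z) ^ m / (m.factorial : ℂ) *
      taylorSum (N - m) (fun j => F (m + j)) z = F 0 z := by
    simp only [taylorSum]
    rw [sum_taylor_shift _ _ (fun m => F m z)]
    obtain ⟨M, rfl⟩ := Nat.exists_eq_succ_of_ne_zero hN.ne'
    simp [Finset.sum_range_succ']
  have h2 : ∀ m ∈ Finset.range N, (z + (starRingEnd ℂ) z) ^ m / (m.factorial : ℂ) *
      taylorSum (N - m) (fun j => F (m + j)) z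
      = Complex.I * (F m 0).im * (z + (starRingEnd ℂ) z) ^ m / (m.factorial : ℂ)
      + 1 / (2 * Real.pi) * ((z + (starRingEnd ℂ) z) ^ m / (m.factorial : ℂ) *
        ∑ j ∈ Finset.range (N - m), 1 / (j.factorial : ℂ) *
          (distRe (u (m + j))).1 ((-twoCos) ^ j * schwarzKernel hz)) := fun m hm => by
    have hm := Finset.mem_range.1 hm
    rw [(hF.shift hm.le).taylorSum_eq (by omega) hz, add_zero]
    ring
  rw [← h1, Finset.sum_congr rfl h2, Finset.sum_add_distrib, Finset.sum_add_distrib,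
    ← Finset.mul_sum, sum_taylor_shift_dist _ _ _ (fun m => distRe (u m)), Finset.mul_sum]
  congr 1
  refine Finset.sum_congr rfl fun m _ => ?_
  -- The regrouping yields (z + z̄ - 2cos t)ᵐ, while the kernel has the opposite difference; hence
  -- the sign (-1)ᵐ.
  have h3 : schwarzKernel hz * (algebraMap ℂ circleTest (z + (starRingEnd ℂ) z) + -twoCos) ^ m
      = ((-1) ^ m : ℂ) • (⟨schwarzTest m z, schwarzTest_mem m hz⟩ : circleTest) := by
    rw [schwarzTest_eq m hz, ← mul_smul_comm, Algebra.smul_def, map_pow, map_neg, map_one,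
      ← mul_pow]
    congr 2
    ring
  rw [h3, map_smul, distPair_eq _ (schwarzTest_mem m hz), smul_eq_mul]
  have h1 : (m.factorial : ℂ) ≠ 0 := by exact_mod_cast m.factorial_ne_zero
  have hpi : (Real.pi : ℂ) ≠ 0 := by exact_mod_cast Real.pi_ne_zero
  field_simp

end IsDbarChain

/-! ### The homogeneous Schwarz problem -/

namespace SolvesHomogeneousSchwarz

variable {n : ℕ} {h₀ : ℂ → ℂ} {η : ℕ → CircleDist} {cs : ℕ → ℝ} {f : ℂ → ℂ}

theorem isDbarChain (hf : SolvesHomogeneousSchwarz n h₀ η cs f) :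
    IsDbarChain n (fun k => dbar^[k] f) (fun k => boundaryValue (dbar^[k] f)) where
  differentiable := hf.differentiable
  dbar_eq m _ z _ := by rw [Function.iterate_succ_apply']
  eq_zero := hf.equation
  isBoundaryValue m hm := (hf.hasBoundaryValue m hm).isBoundaryValue

/-- The explicit solution of the homogeneous problem, with its `∂/∂z̄`-derivatives. -/
theorem iterate_dbar_eq (hf : SolvesHomogeneousSchwarz n h₀ η cs f) {k : ℕ} (hk : k < n) {z : ℂ}
    (hz : z ∈ unitDisk) :
    dbar^[k] f z = ∑ l ∈ Finset.Ico k n, (Complex.I * cs l *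
        (z + (starRingEnd ℂ) z) ^ (l - k) / ((l - k).factorial : ℂ)
      + (-1) ^ (l - k) / (2 * Real.pi * ((l - k).factorial : ℂ)) *
        distPair (distRe (boundaryValue (dbar^[l] f))) (schwarzTest (l - k) z)) := by
  rw [Finset.sum_Ico_eq_sum_range]
  have h := (hf.isDbarChain.shift hk.le).apply_eq (by omega) hz
  rw [add_zero] at h
  rw [h]
  refine Finset.sum_congr rfl fun m hm => ?_
  rw [Nat.add_sub_cancel_left, hf.im_zero (k + m) (by have := Finset.mem_range.1 hm; omega)]

end SolvesHomogeneousSchwarz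

/-! ### The explicit formula and its verification -/

theorem holomorphicPart_eq {h : ℂ → ℂ} (hh : h ∈ Hb) (c : ℝ) {z : ℂ} (hz : z ∈ unitDisk) :
    holomorphicPart h c z = h z + Complex.I * ((c - (h 0).im : ℝ) : ℂ) := by
  have hb := hh.2.isBoundaryValue
  have hpi : (Real.pi : ℂ) ≠ 0 := by exact_mod_cast Real.pi_ne_zero
  rw [holomorphicPart, hb.distPair_distIm_one hh.1, hb.distPair_poissonTest hh.1 hz]
  push_cast
  field_simp
  ring

/-- Substituting the explicit derivatives of `f` gives all terms directly except the one with datum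
`h₀`, where the Schwarz and Poisson formulas must be matched. -/
theorem schwarzSolution_eq {n : ℕ} (hn : 1 ≤ n) {h₀ : ℂ → ℂ} (hh₀ : h₀ ∈ Hb)
    {η : ℕ → CircleDist} {cs : ℕ → ℝ} {f : ℂ → ℂ} (hf : SolvesHomogeneousSchwarz n h₀ η cs f)
    (h : ℂ → ℂ) (c : ℝ) {z : ℂ} (hz : z ∈ unitDisk) :
    schwarzSolution n h₀ η cs h c z = holomorphicPart h c z - ∑ k ∈ Finset.Icc 1 n,
      (-1) ^ k / (k.factorial : ℂ) * (starRingEnd ℂ) z ^ k * dbar^[k - 1] f z := by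
  have hpi : (Real.pi : ℂ) ≠ 0 := by exact_mod_cast Real.pi_ne_zero
  have hb := hh₀.2.isBoundaryValue
  set B : ℕ → ℕ → ℂ := fun k l => (-1) ^ (l + 1) /
      (2 * Real.pi * (k.factorial : ℂ) * ((l - (k - 1)).factorial : ℂ))
      * (starRingEnd ℂ) z ^ k *
        distPair (distRe (boundaryValue (dbar^[l] f))) (schwarzTest (l - (k - 1)) z) with hB
  have hterm : ∀ k ∈ Finset.Icc 1 n,
      (-1) ^ k / (k.factorial : ℂ) * (starRingEnd ℂ) z ^ k * dbar^[k - 1] f z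
      = Complex.I * (∑ l ∈ Finset.Icc (k - 1) (n - 1),
        ((-1) ^ k * (cs l : ℂ)) / ((k.factorial : ℂ) * ((l - (k - 1)).factorial : ℂ))
          * (starRingEnd ℂ) z ^ k * (z + (starRingEnd ℂ) z) ^ (l - (k - 1)))
        + ∑ l ∈ Finset.Icc (k - 1) (n - 1), B k l := fun k hk => by
    obtain ⟨hk1, hkn⟩ := Finset.mem_Icc.1 hk
    have hI : Finset.Ico (k - 1) n = Finset.Icc (k - 1) (n - 1) := by
      ext l; simp only [Finset.mem_Ico, Finset.mem_Icc]; omega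
    rw [hf.iterate_dbar_eq (by omega) hz, hI, Finset.mul_sum, Finset.mul_sum,
      ← Finset.sum_add_distrib]
    refine Finset.sum_congr rfl fun l hl => ?_
    have hl := (Finset.mem_Icc.1 hl).1
    have h1 : (k.factorial : ℂ) ≠ 0 := by exact_mod_cast k.factorial_ne_zero
    have h2 : ((l - (k - 1)).factorial : ℂ) ≠ 0 := by
      exact_mod_cast (l - (k - 1)).factorial_ne_zero
    have h3 : (-1 : ℂ) ^ (l + 1) = (-1) ^ k * (-1) ^ (l - (k - 1)) := by
      rw [← pow_add]; congr 1; omega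
    simp only [hB, h3]
    field_simp
  -- The index l = 0, whose datum is Re (h₀)_b and not some `η l`, occurs only for k = 1.
  have hsplit : ∀ k ∈ Finset.Icc 1 n, ∑ l ∈ Finset.Icc (k - 1) (n - 1), B k l
      = (if k = 1 then B 1 0 else 0) + ∑ l ∈ Finset.Icc (max 1 (k - 1)) (n - 1),
        (-1) ^ (l + 1) /
            (2 * Real.pi * (k.factorial : ℂ) * ((l - (k - 1)).factorial : ℂ))
          * (starRingEnd ℂ) z ^ k * distPair (η l) (schwarzTest (l - (k - 1)) z) := fun k hk => by
    obtain ⟨hk1, hkn⟩ := Finset.mem_Icc.1 hk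
    have hη : ∑ l ∈ Finset.Icc (max 1 (k - 1)) (n - 1),
        (-1) ^ (l + 1) /
            (2 * Real.pi * (k.factorial : ℂ) * ((l - (k - 1)).factorial : ℂ))
          * (starRingEnd ℂ) z ^ k * distPair (η l) (schwarzTest (l - (k - 1)) z)
        = ∑ l ∈ Finset.Icc (max 1 (k - 1)) (n - 1), B k l := by
      refine Finset.sum_congr rfl fun l hl => ?_
      have hl := Finset.mem_Icc.1 hl
      simp only [hB, hf.re_boundary l (by omega) (by omega)]
    rw [hη]
    split_ifs with hk
    · subst hk
      have hI : Finset.Icc (1 - 1) (n - 1) = insert 0 (Finset.Icc (max 1 (1 - 1)) (n - 1)) := by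
        ext l; simp only [Finset.mem_insert, Finset.mem_Icc]; omega
      rw [hI, Finset.sum_insert (by simp)]
    · rw [zero_add, max_eq_right (by omega)]
  -- Here the kernel has exponent 0, so the Schwarz formula evaluates the pairing.
  have h0 : B 1 0 = -((starRingEnd ℂ) z * (h₀ z - Complex.I * (h₀ 0).im)) := by
    have hs := hb.schwarz_formula hh₀.1 hz
    have e : (⟨schwarzTest 0 z, schwarzTest_mem 0 hz⟩ : circleTest) = schwarzKernel hz := rfl
    simp only [hB, Function.iterate_zero, id_eq, hf.re_boundary_zero, Nat.sub_self]
    rw [distPair_eq _ (schwarzTest_mem 0 hz), e, hs]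
    simp
    ring
  rw [Finset.sum_congr rfl hterm, Finset.sum_add_distrib, Finset.sum_congr rfl hsplit,
    Finset.sum_add_distrib, Finset.sum_ite_eq' , if_pos (Finset.mem_Icc.2 ⟨le_rfl, hn⟩), h0,
    schwarzSolution, holomorphicPart, hb.distPair_distIm_one hh₀.1,
    hb.distPair_poissonTest hh₀.1 hz, ← Finset.mul_sum]
  have e1 : Complex.I / (2 * Real.pi) * (2 * Real.pi * (h₀ 0).im) = Complex.I * (h₀ 0).im := by
    field_simp
  have e2 : 1 / (2 * (Real.pi : ℂ)) * (2 * Real.pi * h₀ z) = h₀ z := by field_simp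
  rw [e1, e2]
  ring

theorem differentiableOn_holomorphicPart {h : ℂ → ℂ} (hh : h ∈ Hb) (c : ℝ) :
    DifferentiableOn ℂ (holomorphicPart h c) unitDisk :=
  (hh.1.add_const _).congr fun _ hz => holomorphicPart_eq hh c hz

theorem isBoundaryValue_holomorphicPart {h : ℂ → ℂ} (hh : h ∈ Hb) (c : ℝ) :
    IsBoundaryValue (holomorphicPart h c) (boundaryValue h
      + boundaryValue fun _ => Complex.I * ((c - (h 0).im : ℝ) : ℂ)) :=
  (hh.2.isBoundaryValue.add (hasBoundaryValue_const _).isBoundaryValue hh.1.continuousOn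
    continuousOn_const).congr fun _ hz => (holomorphicPart_eq hh c hz).symm

theorem IsBoundaryValue.conj_pow_mul {f : ℂ → ℂ} {u : CircleDist} (hf : IsBoundaryValue f u)
    (k : ℕ) : IsBoundaryValue (fun z => (starRingEnd ℂ) z ^ k * f z) (distMul (expTest k) u) := by
  rw [expTest_eq_pow]
  refine hf.mul_pow (fun r θ => ?_) k
  rw [expTest_apply, pow_one, map_mul, Complex.conj_ofReal]

theorem SolvesHomogeneousSchwarz.dbar_sum_eq {n : ℕ} {h₀ : ℂ → ℂ} {η : ℕ → CircleDist}
    {cs : ℕ → ℝ} {f : ℂ → ℂ} (hf : SolvesHomogeneousSchwarz n h₀ η cs f) {z : ℂ}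
    (hz : z ∈ unitDisk) :
    dbar (fun w => ∑ k ∈ Finset.Icc 1 n,
      (-1) ^ k / (k.factorial : ℂ) * (starRingEnd ℂ) w ^ k * dbar^[k - 1] f w) z = -f z := by
  have hconj := differentiable_conj z
  have ha : DifferentiableAt ℝ (fun w : ℂ => -1 * (starRingEnd ℂ) w) z := by fun_prop
  have ha' : dbar (fun w : ℂ => -1 * (starRingEnd ℂ) w) z = -1 := by
    rw [dbar_mul (by fun_prop) hconj, dbar_const, dbar_conj]
    ring
  have h := dbar_taylor_sum (F := fun m => dbar^[m] f) ha ha' n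
    (fun m hm => (hf.differentiable m hm).differentiableAt_unitDisk hz)
    -- The variable is now a = -z̄, with k = m + 1; the upper end term vanishes because ∂ⁿf/∂z̄ⁿ =
    -- 0, leaving -f.
    (fun m hm => hf.isDbarChain.dbar_eq m hm z hz)
  have e : (fun w => ∑ k ∈ Finset.Icc 1 n,
      (-1) ^ k / (k.factorial : ℂ) * (starRingEnd ℂ) w ^ k * dbar^[k - 1] f w)
      = fun w => ∑ m ∈ Finset.range n,
        (-1 * (starRingEnd ℂ) w) ^ (m + 1) / ((m + 1).factorial : ℂ) * dbar^[m] f w := by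
    funext w
    have hI : Finset.Icc 1 n = Finset.Ico 1 (n + 1) := by
      ext l; simp only [Finset.mem_Ico, Finset.mem_Icc]; omega
    rw [hI, Finset.sum_Ico_eq_sum_range, Nat.add_sub_cancel]
    refine Finset.sum_congr rfl fun m _ => ?_
    rw [Nat.add_sub_cancel_left, add_comm 1 m, mul_pow]
    ring
  rw [e, h, hf.equation z hz]
  simp

theorem SolvesHomogeneousSchwarz.differentiableOn_sum {n : ℕ} {h₀ : ℂ → ℂ} {η : ℕ → CircleDist}
    {cs : ℕ → ℝ} {f : ℂ → ℂ} (hf : SolvesHomogeneousSchwarz n h₀ η cs f) :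
    ∀ k ∈ Finset.Icc 1 n, DifferentiableOn ℝ (fun w =>
      (-1) ^ k / (k.factorial : ℂ) * (starRingEnd ℂ) w ^ k * dbar^[k - 1] f w) unitDisk :=
  fun k hk => by
  have hconj := differentiable_conj
  have hk := Finset.mem_Icc.1 hk
  refine DifferentiableOn.mul ?_ (hf.differentiable (k - 1) (by omega))
  exact Differentiable.differentiableOn (by fun_prop)

end

theorem mainTheorem3 (n : ℕ) (hn : 1 ≤ n)
    (p : ℕ → ℝ) (hp : ∀ k, 1 ≤ k → k < n → 1 / 2 < p k ∧ p k ≤ 1)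
    (h₀ : ℂ → ℂ) (hh₀ : h₀ ∈ Hb)
    (η : ℕ → CircleDist) (hη : ∀ k, 1 ≤ k → k < n → η k ∈ reHardyBoundary (p k))
    (cs : ℕ → ℝ)
    (f : ℂ → ℂ) (hf : SolvesHomogeneousSchwarz n h₀ η cs f)
    (h : ℂ → ℂ) (hh : h ∈ Hb) (c : ℝ) :
    SolvesFirstOrderSchwarz f
      (distRe (boundaryValue h - ∑ k ∈ Finset.Icc 1 n,
        ((-1) ^ k / (k.factorial : ℂ)) • distMul (expTest k) (boundaryValue (dbar^[k - 1] f))))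
      c (schwarzSolution n h₀ η cs h c) ∧
    DifferentiableOn ℂ (holomorphicPart h c) unitDisk ∧
    ∀ z ∈ unitDisk, schwarzSolution n h₀ η cs h c z =
      holomorphicPart h c z - ∑ k ∈ Finset.Icc 1 n,
        (-1) ^ k / (k.factorial : ℂ) * (starRingEnd ℂ) z ^ k * dbar^[k - 1] f z := by
  have hw : ∀ z ∈ unitDisk, schwarzSolution n h₀ η cs h c z =
      holomorphicPart h c z - ∑ k ∈ Finset.Icc 1 n,
        (-1) ^ k / (k.factorial : ℂ) * (starRingEnd ℂ) z ^ k * dbar^[k - 1] f z :=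
    fun z hz => schwarzSolution_eq hn hh₀ hf h c hz
  have hw₀ := differentiableOn_holomorphicPart hh c
  have hd := hf.differentiableOn_sum
  have hsum := DifferentiableOn.fun_sum hd
  have hw₀R : DifferentiableOn ℝ (holomorphicPart h c) unitDisk := hw₀.restrictScalars ℝ
  have hbs : IsBoundaryValue (fun w => ∑ k ∈ Finset.Icc 1 n,
      (-1) ^ k / (k.factorial : ℂ) * (starRingEnd ℂ) w ^ k * dbar^[k - 1] f w)
      (∑ k ∈ Finset.Icc 1 n,
        ((-1) ^ k / (k.factorial : ℂ)) • distMul (expTest k) (boundaryValue (dbar^[k - 1] f))) := by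
    refine IsBoundaryValue.sum (fun k hk => ?_) fun k hk => (hd k hk).continuousOn
    have hk := Finset.mem_Icc.1 hk
    simp only [mul_assoc]
    exact ((hf.isDbarChain.isBoundaryValue (k - 1) (by omega)).conj_pow_mul k).const_mul _
  have hbw := ((isBoundaryValue_holomorphicPart hh c).add (hbs.const_mul (-1))
    hw₀R.continuousOn (continuousOn_const.mul hsum.continuousOn)).congr
    (g := schwarzSolution n h₀ η cs h c) fun z hz => by rw [hw z hz]; ring
  refine ⟨⟨(hw₀R.sub hsum).congr hw, fun z hz => ?_, ⟨_, hbw⟩, ?_, ?_⟩, hw₀, hw⟩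
  · rw [dbar_congr (g := fun z => holomorphicPart h c z - ∑ k ∈ Finset.Icc 1 n,
        (-1) ^ k / (k.factorial : ℂ) * (starRingEnd ℂ) z ^ k * dbar^[k - 1] f z) hw hz,
      dbar_sub (hw₀R.differentiableAt_unitDisk hz) (hsum.differentiableAt_unitDisk hz),
      hf.dbar_sum_eq hz, dbar_eq_zero (hw₀.differentiableAt (isOpen_unitDisk.mem_nhds hz))]
    ring
  · have e : ∀ s : CircleDist, (-1 : ℂ) • s = -s := fun s =>
      dist_ext fun φ => neg_one_mul (s.1 φ)
    -- The holomorphic part differs from `h` by an imaginary constant, which the real part discards.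
    rw [hbw.boundaryValue_eq, e, add_right_comm, distRe_add, distRe_boundaryValue_I_mul, add_zero,
      sub_eq_add_neg]
  · have h0 : ∑ k ∈ Finset.Icc 1 n, (-1) ^ k / (k.factorial : ℂ) * (starRingEnd ℂ) (0 : ℂ) ^ k
        * dbar^[k - 1] f 0 = 0 := Finset.sum_eq_zero fun k hk => by
      have hk := (Finset.mem_Icc.1 hk).1
      rw [map_zero, zero_pow (by omega), mul_zero, zero_mul]
    rw [hw 0 zero_mem_unitDisk, h0, sub_zero, holomorphicPart_eq hh c zero_mem_unitDisk]
    simp
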